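/- Let $N\ge 2$, let $\Omega\subseteq\mathbb R^N$ be a bounded domain (nonempty, open, connected) with Lipschitz boundary, let $p,q\in C(\overline\Omega)$ satisfy $1<p(x)<N$ and $p(x)<q(x)$ for all $x\in\overline\Omega$, and let $0\le\mu\in L^1(\Omega)$. Put $\mathcal H(x,t)=t^{p(x)}+\mu(x)t^{q(x)}$ for $x\in\Omega$, $t\ge 0$, let $L^{\mathcal H}(\Omega)$ be the space of (classes of) measurable $u\colon\Omega\to\mathbb R$ with $\int_\Omega\mathcal H(x,|u|)\,dx<\infty$, and let $W^{1,\mathcal H}(\Omega)$ be the space of all $u\in L^{\mathcal H}(\Omega)$ that have a weak gradient $\nabla u$ on $\Omega$ with $|\nabla u|\in L^{\mathcal H}(\Omega)$. For $u\in W^{1,\mathcal H}(\Omega)$ set $$\hat\rho_{\mathcal H}(u)=\int_\Omega\left(|\nabla u|^{p(x)}+\mu(x)|\nabla u|^{q(x)}\right)dx+\int_\Omega\left(|u|^{p(x)}+\mu(x)|u|^{q(x)}\right)dx,\qquad \|u\|_{\hat\rho_{\mathcal H}}=\inf\{\lambda>0:\hat\rho_{\mathcal H}(u/\lambda)\le 1\},$$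 and equip $W^{1,\mathcal H}(\Omega)$ with the norm $\|\cdot\|_{\hat\rho_{\mathcal H}}$. Then: (i) The norm $\|\cdot\|_{\hat\rho_{\mathcal H}}$ on $W^{1,\mathcal H}(\Omega)$ is uniformly convex: for every $\varepsilon>0$ there is $\delta>0$ such that $\|u+v\|_{\hat\rho_{\mathcal H}}\le 2-\delta$ whenever $\|u\|_{\hat\rho_{\mathcal H}}=\|v\|_{\hat\rho_{\mathcal H}}=1$ and $\|u-v\|_{\hat\rho_{\mathcal H}}\ge\varepsilon$. (ii) If $(u_n)_{n\in\mathbb N}\subseteq W^{1,\mathcal H}(\Omega)$ and $u\in W^{1,\mathcal H}(\Omega)$ satisfy $u_n\rightharpoonup u$ weakly in $W^{1,\mathcal H}(\Omega)$ and $\hat\rho_{\mathcal H}(u_n)\to\hat\rho_{\mathcal H}(u)$, then $u_n\to u$ in $W^{1,\mathcal H}(\Omega)$. -/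

import Mathlib

open MeasureTheory Filter Topology Set
open scoped ENNReal ContDiff

noncomputable section

namespace DoublePhase

/-- `Ω` has Lipschitz boundary: near each boundary point, in suitable orthogonal coordinates
(`ν` is the vertical direction), `Ω` is the strict epigraph of a Lipschitz function defined on
the hyperplane orthogonal to `ν`. -/
def HasLipschitzBoundary {N : ℕ} (Ω : Set (EuclideanSpace ℝ (Fin N))) : Prop :=
  ∀ x₀ ∈ frontier Ω, ∃ (r : ℝ) (ν : EuclideanSpace ℝ (Fin N)) (K : NNReal)
    (γ : (Submodule.span ℝ {ν})ᗮ → ℝ), 0 < r ∧ ‖ν‖ = 1 ∧ LipschitzWith K γ ∧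
      ∀ x ∈ Metric.ball x₀ r,
        (x ∈ Ω ↔ γ ((Submodule.span ℝ {ν})ᗮ.orthogonalProjectionOnto x) < inner ℝ ν x)

/-- The standing hypotheses: `Ω ⊆ ℝᴺ`, `N ≥ 2`, is a bounded domain (nonempty, open, connected)
with Lipschitz boundary; `p` and `q` are continuous on the closure of `Ω`, with
`1 < p(x) < N` and `p(x) < q(x)` there; and `0 ≤ μ ∈ L¹(Ω)`. -/
structure Hypotheses {N : ℕ} (Ω : Set (EuclideanSpace ℝ (Fin N)))
    (p q μ : EuclideanSpace ℝ (Fin N) → ℝ) : Prop where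
  two_le_dim : 2 ≤ N
  isOpen : IsOpen Ω
  isConnected : IsConnected Ω
  isBounded : Bornology.IsBounded Ω
  lipschitzBoundary : HasLipschitzBoundary Ω
  continuousOn_p : ContinuousOn p (closure Ω)
  continuousOn_q : ContinuousOn q (closure Ω)
  one_lt_p : ∀ x ∈ closure Ω, 1 < p x
  p_lt_dim : ∀ x ∈ closure Ω, p x < N
  p_lt_q : ∀ x ∈ closure Ω, p x < q x
  weight_nonneg : ∀ᵐ x ∂(volume.restrict Ω), 0 ≤ μ x
  weight_integrable : IntegrableOn μ Ω

/-- The double phase function `H(x, t) = t ^ p(x) + μ(x) t ^ q(x)`. -/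
def H {N : ℕ} (p q μ : EuclideanSpace ℝ (Fin N) → ℝ) (x : EuclideanSpace ℝ (Fin N)) (t : ℝ) : ℝ :=
  t ^ p x + μ x * t ^ q x

/-- The modular `ρ_H(v) = ∫_Ω H(x, |v(x)|) dx`, with values in `[0, ∞]`, for (classes of)
measurable functions `v` on `Ω` that are real valued or vector valued. -/
def modular {N : ℕ} (Ω : Set (EuclideanSpace ℝ (Fin N))) (p q μ : EuclideanSpace ℝ (Fin N) → ℝ)
    {F : Type*} [NormedAddCommGroup F]
    (v : EuclideanSpace ℝ (Fin N) →ₘ[volume.restrict Ω] F) : ℝ≥0∞ :=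
  ∫⁻ x in Ω, ENNReal.ofReal (H p q μ x ‖v x‖)

/-- `g` is the weak gradient of `u` on `Ω`: both are locally integrable on `Ω` and
`∫_Ω u ∂ᵢφ = -∫_Ω gᵢ φ` for every test function `φ ∈ C_c^∞(Ω)` and every `i`. -/
def IsWeakGradient {N : ℕ} (Ω : Set (EuclideanSpace ℝ (Fin N)))
    (u : EuclideanSpace ℝ (Fin N) →ₘ[volume.restrict Ω] ℝ)
    (g : EuclideanSpace ℝ (Fin N) →ₘ[volume.restrict Ω] EuclideanSpace ℝ (Fin N)) : Prop :=
  LocallyIntegrableOn u Ω ∧ LocallyIntegrableOn g Ω ∧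
    ∀ φ : EuclideanSpace ℝ (Fin N) → ℝ, ContDiff ℝ ∞ φ → HasCompactSupport φ → tsupport φ ⊆ Ω →
      ∀ i : Fin N, ∫ x in Ω, u x * fderiv ℝ φ x (EuclideanSpace.single i 1)
        = -∫ x in Ω, g x i * φ x

open Classical in
/-- The weak gradient of `u` on `Ω` (it is unique, see `IsWeakGradient.unique`); `0` if there is
none. -/
def weakGradient {N : ℕ} (Ω : Set (EuclideanSpace ℝ (Fin N)))
    (u : EuclideanSpace ℝ (Fin N) →ₘ[volume.restrict Ω] ℝ) :
    EuclideanSpace ℝ (Fin N) →ₘ[volume.restrict Ω] EuclideanSpace ℝ (Fin N) :=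
  if h : ∃ g, IsWeakGradient Ω u g then h.choose else 0

section WeakGradient

variable {N : ℕ} {Ω : Set (EuclideanSpace ℝ (Fin N))}

theorem locallyIntegrableOn_congr {F : Type*} [NormedAddCommGroup F] (hΩ : IsOpen Ω)
    {f g : EuclideanSpace ℝ (Fin N) → F} (hf : LocallyIntegrableOn f Ω)
    (h : f =ᵐ[volume.restrict Ω] g) : LocallyIntegrableOn g Ω := by
  rw [locallyIntegrableOn_iff hΩ.isLocallyClosed] at hf ⊢
  intro k hk hkc
  exact (hf k hk hkc).congr_fun_ae (ae_restrict_of_ae_restrict_of_subset hk h)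

theorem integrable_mul_test {f ψ : EuclideanSpace ℝ (Fin N) → ℝ}
    (hf : LocallyIntegrableOn f Ω) (hψ : Continuous ψ) (hc : HasCompactSupport ψ)
    (hs : tsupport ψ ⊆ Ω) : IntegrableOn (fun x => f x * ψ x) Ω := by
  have h1 := (hf.integrableOn_compact_subset hs hc).mul_continuousOn hψ.continuousOn hc
  refine Integrable.integrableOn ?_
  refine (integrableOn_iff_integrable_of_support_subset ?_).1 h1
  intro x hx
  apply subset_tsupport
  intro h0
  exact hx (by simp [h0])

theorem locallyIntegrableOn_coord {g : EuclideanSpace ℝ (Fin N) → EuclideanSpace ℝ (Fin N)}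
    (hΩ : IsOpen Ω) (hg : LocallyIntegrableOn g Ω) (i : Fin N) :
    LocallyIntegrableOn (fun x => g x i) Ω := by
  rw [locallyIntegrableOn_iff hΩ.isLocallyClosed] at hg ⊢
  intro k hk hkc
  exact (EuclideanSpace.proj (𝕜 := ℝ) i).integrable_comp (hg k hk hkc)

theorem IsWeakGradient.unique (hΩ : IsOpen Ω)
    {u : EuclideanSpace ℝ (Fin N) →ₘ[volume.restrict Ω] ℝ}
    {g g' : EuclideanSpace ℝ (Fin N) →ₘ[volume.restrict Ω] EuclideanSpace ℝ (Fin N)}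
    (h : IsWeakGradient Ω u g) (h' : IsWeakGradient Ω u g') : g = g' := by
  have key : ∀ i : Fin N, ∀ᵐ x ∂(volume : Measure (EuclideanSpace ℝ (Fin N))),
      x ∈ Ω → g x i - g' x i = 0 := by
    intro i
    have hgi := locallyIntegrableOn_coord hΩ h.2.1 i
    have hgi' := locallyIntegrableOn_coord hΩ h'.2.1 i
    refine hΩ.ae_eq_zero_of_integral_contDiff_smul_eq_zero (hgi.sub hgi') ?_
    intro φ hφ hc hs
    have e1 := h.2.2 φ hφ hc hs i
    have e2 := h'.2.2 φ hφ hc hs i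
    have i1 := integrable_mul_test hgi hφ.continuous hc hs
    have i2 := integrable_mul_test hgi' hφ.continuous hc hs
    have e3 := integral_sub i1 i2
    have e4 : ∫ x in Ω, φ x • ((fun x => g x i) - (fun x => g' x i)) x
        = ∫ x, φ x • ((fun x => g x i) - (fun x => g' x i)) x := by
      refine setIntegral_eq_integral_of_forall_compl_eq_zero ?_
      intro x hx
      have : φ x = 0 := image_eq_zero_of_notMem_tsupport (fun hx' => hx (hs hx'))
      simp [this]
    refine e4.symm.trans ?_
    have e5 : ∫ x in Ω, φ x • ((fun x => g x i) - (fun x => g' x i)) x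
        = ∫ x in Ω, (g x i * φ x - g' x i * φ x) := by
      congr 1
      ext x
      simp only [Pi.sub_apply, smul_eq_mul]
      ring
    rw [e5, e3]
    linarith
  apply AEEqFun.ext
  rw [EventuallyEq, ae_restrict_iff' hΩ.measurableSet]
  filter_upwards [ae_all_iff.2 key] with x hx hxΩ
  ext i
  linarith [hx i hxΩ]

theorem IsWeakGradient.add (hΩ : IsOpen Ω)
    {u v : EuclideanSpace ℝ (Fin N) →ₘ[volume.restrict Ω] ℝ}
    {g k : EuclideanSpace ℝ (Fin N) →ₘ[volume.restrict Ω] EuclideanSpace ℝ (Fin N)}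
    (h : IsWeakGradient Ω u g) (h' : IsWeakGradient Ω v k) :
    IsWeakGradient Ω (u + v) (g + k) := by
  refine ⟨locallyIntegrableOn_congr hΩ (h.1.add h'.1) (AEEqFun.coeFn_add u v).symm,
    locallyIntegrableOn_congr hΩ (h.2.1.add h'.2.1) (AEEqFun.coeFn_add g k).symm, ?_⟩
  intro φ hφ hc hs i
  have hd : Continuous fun x => fderiv ℝ φ x (EuclideanSpace.single i 1) :=
    (hφ.continuous_fderiv (by simp)).clm_apply continuous_const
  have hdc : HasCompactSupport fun x => fderiv ℝ φ x (EuclideanSpace.single i 1) :=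
    hc.fderiv_apply (𝕜 := ℝ) _
  have hds : tsupport (fun x => fderiv ℝ φ x (EuclideanSpace.single i 1)) ⊆ Ω :=
    (tsupport_fderiv_apply_subset ℝ _).trans hs
  have e1 := integral_add (integrable_mul_test h.1 hd hdc hds)
    (integrable_mul_test h'.1 hd hdc hds)
  have e2 := integral_add
    (integrable_mul_test (locallyIntegrableOn_coord hΩ h.2.1 i) hφ.continuous hc hs)
    (integrable_mul_test (locallyIntegrableOn_coord hΩ h'.2.1 i) hφ.continuous hc hs)
  have e3 : ∫ x in Ω, (u + v) x * fderiv ℝ φ x (EuclideanSpace.single i 1)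
      = ∫ x in Ω, (u x * fderiv ℝ φ x (EuclideanSpace.single i 1)
        + v x * fderiv ℝ φ x (EuclideanSpace.single i 1)) := by
    refine integral_congr_ae ?_
    filter_upwards [AEEqFun.coeFn_add u v] with x hx
    simp [hx, add_mul]
  have e4 : ∫ x in Ω, (g + k) x i * φ x = ∫ x in Ω, (g x i * φ x + k x i * φ x) := by
    refine integral_congr_ae ?_
    filter_upwards [AEEqFun.coeFn_add g k] with x hx
    simp [hx, add_mul]
  rw [e3, e4, e1, e2, h.2.2 φ hφ hc hs i, h'.2.2 φ hφ hc hs i]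
  ring

theorem IsWeakGradient.smul (hΩ : IsOpen Ω) (c : ℝ)
    {u : EuclideanSpace ℝ (Fin N) →ₘ[volume.restrict Ω] ℝ}
    {g : EuclideanSpace ℝ (Fin N) →ₘ[volume.restrict Ω] EuclideanSpace ℝ (Fin N)}
    (h : IsWeakGradient Ω u g) : IsWeakGradient Ω (c • u) (c • g) := by
  refine ⟨locallyIntegrableOn_congr hΩ (h.1.smul c) (AEEqFun.coeFn_smul c u).symm,
    locallyIntegrableOn_congr hΩ (h.2.1.smul c) (AEEqFun.coeFn_smul c g).symm, ?_⟩
  intro φ hφ hc hs i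
  have e3 : ∫ x in Ω, (c • u) x * fderiv ℝ φ x (EuclideanSpace.single i 1)
      = ∫ x in Ω, c * (u x * fderiv ℝ φ x (EuclideanSpace.single i 1)) := by
    refine integral_congr_ae ?_
    filter_upwards [AEEqFun.coeFn_smul c u] with x hx
    simp [hx, mul_assoc]
  have e4 : ∫ x in Ω, (c • g) x i * φ x = ∫ x in Ω, c * (g x i * φ x) := by
    refine integral_congr_ae ?_
    filter_upwards [AEEqFun.coeFn_smul c g] with x hx
    simp [hx, mul_assoc]
  rw [e3, e4, integral_const_mul, integral_const_mul, h.2.2 φ hφ hc hs i]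
  ring

theorem isWeakGradient_zero (hΩ : IsOpen Ω) :
    IsWeakGradient Ω (0 : EuclideanSpace ℝ (Fin N) →ₘ[volume.restrict Ω] ℝ) 0 := by
  refine ⟨locallyIntegrableOn_congr hΩ (locallyIntegrableOn_zero) AEEqFun.coeFn_zero.symm,
    locallyIntegrableOn_congr hΩ (locallyIntegrableOn_zero) AEEqFun.coeFn_zero.symm, ?_⟩
  intro φ hφ hc hs i
  have e3 : ∫ x in Ω, (0 : EuclideanSpace ℝ (Fin N) →ₘ[volume.restrict Ω] ℝ) x *
      fderiv ℝ φ x (EuclideanSpace.single i 1) = 0 := by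
    refine integral_eq_zero_of_ae ?_
    filter_upwards [AEEqFun.coeFn_zero (α := EuclideanSpace ℝ (Fin N)) (β := ℝ)
      (μ := volume.restrict Ω)] with x hx
    simp [hx]
  have e4 : ∫ x in Ω, (0 : EuclideanSpace ℝ (Fin N) →ₘ[volume.restrict Ω]
      EuclideanSpace ℝ (Fin N)) x i * φ x = 0 := by
    refine integral_eq_zero_of_ae ?_
    filter_upwards [AEEqFun.coeFn_zero (α := EuclideanSpace ℝ (Fin N))
      (β := EuclideanSpace ℝ (Fin N)) (μ := volume.restrict Ω)] with x hx
    simp [hx]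
  rw [e3, e4, neg_zero]

theorem IsWeakGradient.weakGradient_eq (hΩ : IsOpen Ω)
    {u : EuclideanSpace ℝ (Fin N) →ₘ[volume.restrict Ω] ℝ}
    {g : EuclideanSpace ℝ (Fin N) →ₘ[volume.restrict Ω] EuclideanSpace ℝ (Fin N)}
    (h : IsWeakGradient Ω u g) : weakGradient Ω u = g := by
  have h' : ∃ g, IsWeakGradient Ω u g := ⟨g, h⟩
  rw [weakGradient, dif_pos h']
  exact h'.choose_spec.unique hΩ h

end WeakGradient

section Modular

variable {N : ℕ} {Ω : Set (EuclideanSpace ℝ (Fin N))} {p q μ : EuclideanSpace ℝ (Fin N) → ℝ}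

theorem H_nonneg {x : EuclideanSpace ℝ (Fin N)} (hμ : 0 ≤ μ x) {t : ℝ} (ht : 0 ≤ t) :
    0 ≤ H p q μ x t :=
  add_nonneg (Real.rpow_nonneg ht _) (mul_nonneg hμ (Real.rpow_nonneg ht _))

theorem H_mono {x : EuclideanSpace ℝ (Fin N)} (hp : 1 < p x) (hpq : p x < q x) (hμ : 0 ≤ μ x)
    {s t : ℝ} (hs : 0 ≤ s) (hst : s ≤ t) : H p q μ x s ≤ H p q μ x t :=
  add_le_add (Real.rpow_le_rpow hs hst (by linarith))
    (mul_le_mul_of_nonneg_left (Real.rpow_le_rpow hs hst (by linarith)) hμ)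

theorem H_convex {x : EuclideanSpace ℝ (Fin N)} (hp : 1 < p x) (hpq : p x < q x) (hμ : 0 ≤ μ x)
    {s t a b : ℝ} (hs : 0 ≤ s) (ht : 0 ≤ t) (ha : 0 ≤ a) (hb : 0 ≤ b) (hab : a + b = 1) :
    H p q μ x (a * s + b * t) ≤ a * H p q μ x s + b * H p q μ x t := by
  have h1 := (convexOn_rpow hp.le).2 hs ht ha hb hab
  have h2 := (convexOn_rpow (hp.trans hpq).le).2 hs ht ha hb hab
  simp only [smul_eq_mul] at h1 h2
  have h3 := mul_le_mul_of_nonneg_left h2 hμ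
  unfold H
  linarith

theorem H_mul_le {x : EuclideanSpace ℝ (Fin N)} (hpq : p x < q x) (hμ : 0 ≤ μ x)
    {Q c t : ℝ} (hQ : q x ≤ Q) (hc : 1 ≤ c) (ht : 0 ≤ t) :
    H p q μ x (c * t) ≤ c ^ Q * H p q μ x t := by
  have hc0 : 0 ≤ c := by linarith
  have h1 : c ^ p x ≤ c ^ Q := Real.rpow_le_rpow_of_exponent_le hc (by linarith)
  have h2 : c ^ q x ≤ c ^ Q := Real.rpow_le_rpow_of_exponent_le hc hQ
  have h3 := mul_le_mul_of_nonneg_right h1 (Real.rpow_nonneg ht (p x))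
  have h4 := mul_le_mul_of_nonneg_left
    (mul_le_mul_of_nonneg_right h2 (Real.rpow_nonneg ht (q x))) hμ
  unfold H
  rw [Real.mul_rpow hc0 ht, Real.mul_rpow hc0 ht]
  linarith

theorem Hypotheses.ae_exponents (h : Hypotheses Ω p q μ) :
    ∀ᵐ x ∂(volume.restrict Ω), x ∈ Ω ∧ 1 < p x ∧ p x < q x ∧ 0 ≤ μ x := by
  filter_upwards [h.weight_nonneg, ae_restrict_mem h.isOpen.measurableSet] with x hx hxΩ
  exact ⟨hxΩ, h.one_lt_p x (subset_closure hxΩ), h.p_lt_q x (subset_closure hxΩ), hx⟩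

variable {F : Type*} [NormedAddCommGroup F]

theorem Hypotheses.aemeasurable_H (h : Hypotheses Ω p q μ)
    (v : EuclideanSpace ℝ (Fin N) →ₘ[volume.restrict Ω] F) :
    AEMeasurable (fun x => ENNReal.ofReal (H p q μ x ‖v x‖)) (volume.restrict Ω) := by
  have hp : AEMeasurable p (volume.restrict Ω) :=
    (h.continuousOn_p.mono subset_closure).aemeasurable h.isOpen.measurableSet
  have hq : AEMeasurable q (volume.restrict Ω) :=
    (h.continuousOn_q.mono subset_closure).aemeasurable h.isOpen.measurableSet
  have hμ : AEMeasurable μ (volume.restrict Ω) := h.weight_integrable.aestronglyMeasurable.aemeasurable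
  have hv : AEMeasurable (fun x => ‖v x‖) (volume.restrict Ω) :=
    v.aestronglyMeasurable.norm.aemeasurable
  exact ((hv.pow hp).add (hμ.mul (hv.pow hq))).ennreal_ofReal

theorem Hypotheses.modular_zero (h : Hypotheses Ω p q μ) :
    modular Ω p q μ (0 : EuclideanSpace ℝ (Fin N) →ₘ[volume.restrict Ω] F) = 0 := by
  unfold modular
  rw [lintegral_eq_zero_iff' (h.aemeasurable_H _)]
  filter_upwards [h.ae_exponents, AEEqFun.coeFn_zero (α := EuclideanSpace ℝ (Fin N)) (β := F)
      (μ := volume.restrict Ω)] with x ⟨_, hp, hpq, _⟩ hx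
  have h1 : p x ≠ 0 := by linarith
  have h2 : q x ≠ 0 := by linarith
  simp [hx, H, Real.zero_rpow h1, Real.zero_rpow h2]

theorem Hypotheses.eq_zero_of_modular (h : Hypotheses Ω p q μ)
    (v : EuclideanSpace ℝ (Fin N) →ₘ[volume.restrict Ω] F) (hv : modular Ω p q μ v = 0) :
    v = 0 := by
  unfold modular at hv
  rw [lintegral_eq_zero_iff' (h.aemeasurable_H _)] at hv
  apply AEEqFun.ext
  filter_upwards [h.ae_exponents, hv, AEEqFun.coeFn_zero (α := EuclideanSpace ℝ (Fin N)) (β := F)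
      (μ := volume.restrict Ω)] with x ⟨_, hp, hpq, hμ⟩ hx h0
  rw [h0, Pi.zero_apply]
  by_contra hne
  have hpos : 0 < ‖v x‖ := norm_pos_iff.2 hne
  have h1 : 0 < H p q μ x ‖v x‖ :=
    add_pos_of_pos_of_nonneg (Real.rpow_pos_of_pos hpos _)
      (mul_nonneg hμ (Real.rpow_nonneg hpos.le _))
  have h2 := ENNReal.ofReal_pos.2 h1
  exact h2.ne' hx

variable [NormedSpace ℝ F]

theorem Hypotheses.modular_convex (h : Hypotheses Ω p q μ) {a b : ℝ} (ha : 0 ≤ a) (hb : 0 ≤ b)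
    (hab : a + b = 1) (u v : EuclideanSpace ℝ (Fin N) →ₘ[volume.restrict Ω] F) :
    modular Ω p q μ (a • u + b • v)
      ≤ ENNReal.ofReal a * modular Ω p q μ u + ENNReal.ofReal b * modular Ω p q μ v := by
  unfold modular
  rw [← lintegral_const_mul'' _ (h.aemeasurable_H u), ← lintegral_const_mul'' _ (h.aemeasurable_H v),
    ← lintegral_add_left' ((h.aemeasurable_H u).const_mul _)]
  refine lintegral_mono_ae ?_
  filter_upwards [h.ae_exponents, AEEqFun.coeFn_add (a • u) (b • v), AEEqFun.coeFn_smul a u,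
    AEEqFun.coeFn_smul b v] with x ⟨_, hp, hpq, hμ⟩ h1 h2 h3
  have e : (a • u + b • v : EuclideanSpace ℝ (Fin N) →ₘ[volume.restrict Ω] F) x
      = a • u x + b • v x := by
    rw [h1, Pi.add_apply, h2, h3, Pi.smul_apply, Pi.smul_apply]
  rw [e, ← ENNReal.ofReal_mul ha, ← ENNReal.ofReal_mul hb,
    ← ENNReal.ofReal_add (mul_nonneg ha (H_nonneg hμ (norm_nonneg _)))
      (mul_nonneg hb (H_nonneg hμ (norm_nonneg _)))]
  refine ENNReal.ofReal_le_ofReal ?_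
  refine le_trans (H_mono hp hpq hμ (norm_nonneg _) ?_)
    (H_convex hp hpq hμ (norm_nonneg _) (norm_nonneg _) ha hb hab)
  refine (norm_add_le _ _).trans (le_of_eq ?_)
  rw [norm_smul, norm_smul, Real.norm_of_nonneg ha, Real.norm_of_nonneg hb]

theorem Hypotheses.modular_smul_le (h : Hypotheses Ω p q μ) {c : ℝ} (hc : |c| ≤ 1)
    (u : EuclideanSpace ℝ (Fin N) →ₘ[volume.restrict Ω] F) :
    modular Ω p q μ (c • u) ≤ ENNReal.ofReal |c| * modular Ω p q μ u := by
  have h1 := h.modular_convex (abs_nonneg c) (sub_nonneg.2 hc) (by ring) u 0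
  rw [h.modular_zero, mul_zero, add_zero, smul_zero, add_zero] at h1
  refine le_trans (le_of_eq ?_) h1
  unfold modular
  refine lintegral_congr_ae ?_
  filter_upwards [AEEqFun.coeFn_smul c u, AEEqFun.coeFn_smul |c| u] with x h2 h3
  rw [h2, h3]
  simp [norm_smul]

theorem Hypotheses.modular_smul_lt_top (h : Hypotheses Ω p q μ) (c : ℝ)
    {u : EuclideanSpace ℝ (Fin N) →ₘ[volume.restrict Ω] F} (hu : modular Ω p q μ u < ⊤) :
    modular Ω p q μ (c • u) < ⊤ := by
  obtain ⟨Q, hQ⟩ := (h.isBounded.isCompact_closure.image_of_continuousOn h.continuousOn_q).bddAbove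
  have key : modular Ω p q μ (c • u)
      ≤ ENNReal.ofReal ((max 1 |c|) ^ Q) * modular Ω p q μ u := by
    unfold modular
    rw [← lintegral_const_mul'' _ (h.aemeasurable_H u)]
    refine lintegral_mono_ae ?_
    filter_upwards [h.ae_exponents, AEEqFun.coeFn_smul c u] with x ⟨hxΩ, hp, hpq, hμ⟩ h1
    rw [h1, ← ENNReal.ofReal_mul (by positivity)]
    refine ENNReal.ofReal_le_ofReal ?_
    refine le_trans (H_mono hp hpq hμ (norm_nonneg _) ?_)
      (H_mul_le hpq hμ (hQ ⟨x, subset_closure hxΩ, rfl⟩) (le_max_left _ _) (norm_nonneg _))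
    rw [Pi.smul_apply, norm_smul, Real.norm_eq_abs]
    exact mul_le_mul_of_nonneg_right (le_max_right _ _) (norm_nonneg _)
  exact key.trans_lt (ENNReal.mul_lt_top ENNReal.ofReal_lt_top hu)

theorem Hypotheses.modular_add_lt_top (h : Hypotheses Ω p q μ)
    {u v : EuclideanSpace ℝ (Fin N) →ₘ[volume.restrict Ω] F} (hu : modular Ω p q μ u < ⊤)
    (hv : modular Ω p q μ v < ⊤) : modular Ω p q μ (u + v) < ⊤ := by
  have e : u + v = (2 : ℝ) • ((1 / 2 : ℝ) • u + (1 / 2 : ℝ) • v) := by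
    rw [smul_add, smul_smul, smul_smul]
    norm_num
  rw [e]
  refine h.modular_smul_lt_top 2 ?_
  refine (h.modular_convex (by norm_num) (by norm_num) (by norm_num) u v).trans_lt ?_
  exact ENNReal.add_lt_top.2 ⟨ENNReal.mul_lt_top ENNReal.ofReal_lt_top hu,
    ENNReal.mul_lt_top ENNReal.ofReal_lt_top hv⟩

end Modular

/-- The Musielak-Orlicz Sobolev space `W^{1,H}(Ω)`, as a linear subspace of the space of (classes
of) measurable functions on `Ω`: the functions `u` that have a weak gradient and for which
`u ∈ L^H(Ω)` and `|∇u| ∈ L^H(Ω)`, that is, `ρ_H(u) < ∞` and `ρ_H(|∇u|) < ∞`. -/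
def sobolevSubmodule {N : ℕ} {Ω : Set (EuclideanSpace ℝ (Fin N))}
    {p q μ : EuclideanSpace ℝ (Fin N) → ℝ} (h : Hypotheses Ω p q μ) :
    Submodule ℝ (EuclideanSpace ℝ (Fin N) →ₘ[volume.restrict Ω] ℝ) where
  carrier := {u | (∃ g, IsWeakGradient Ω u g) ∧ modular Ω p q μ u < ⊤ ∧
    modular Ω p q μ (weakGradient Ω u) < ⊤}
  zero_mem' := by
    refine ⟨⟨0, isWeakGradient_zero h.isOpen⟩, ?_, ?_⟩
    · rw [h.modular_zero]
      exact ENNReal.zero_lt_top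
    · rw [(isWeakGradient_zero h.isOpen).weakGradient_eq h.isOpen, h.modular_zero]
      exact ENNReal.zero_lt_top
  add_mem' := by
    rintro u v ⟨⟨g, hg⟩, hu, hu'⟩ ⟨⟨k, hk⟩, hv, hv'⟩
    rw [hg.weakGradient_eq h.isOpen] at hu'
    rw [hk.weakGradient_eq h.isOpen] at hv'
    refine ⟨⟨g + k, hg.add h.isOpen hk⟩, h.modular_add_lt_top hu hv, ?_⟩
    rw [(hg.add h.isOpen hk).weakGradient_eq h.isOpen]
    exact h.modular_add_lt_top hu' hv'
  smul_mem' := by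
    rintro c u ⟨⟨g, hg⟩, hu, hu'⟩
    rw [hg.weakGradient_eq h.isOpen] at hu'
    refine ⟨⟨c • g, hg.smul h.isOpen c⟩, h.modular_smul_lt_top c hu, ?_⟩
    rw [(hg.smul h.isOpen c).weakGradient_eq h.isOpen]
    exact h.modular_smul_lt_top c hu'

/-- The space `W^{1,H}(Ω)` as a type; below it is endowed with the norm `‖·‖_{ρ̂_H}`. -/
def W1H {N : ℕ} {Ω : Set (EuclideanSpace ℝ (Fin N))}
    {p q μ : EuclideanSpace ℝ (Fin N) → ℝ} (h : Hypotheses Ω p q μ) : Type :=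
  sobolevSubmodule h

namespace W1H

variable {N : ℕ} {Ω : Set (EuclideanSpace ℝ (Fin N))} {p q μ : EuclideanSpace ℝ (Fin N) → ℝ}
  {h : Hypotheses Ω p q μ}

instance instAddCommGroup : AddCommGroup (W1H h) :=
  inferInstanceAs (AddCommGroup (sobolevSubmodule h))

instance instModule : Module ℝ (W1H h) :=
  inferInstanceAs (Module ℝ (sobolevSubmodule h))

/-- The function underlying an element of `W^{1,H}(Ω)`. -/
def toAEEqFun : W1H h →ₗ[ℝ] (EuclideanSpace ℝ (Fin N) →ₘ[volume.restrict Ω] ℝ) :=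
  (sobolevSubmodule h).subtype

/-- The modular `ρ̂_H(u) = ∫_Ω H(x, |∇u|) dx + ∫_Ω H(x, |u|) dx`. -/
def modularHat (u : W1H h) : ℝ≥0∞ :=
  modular Ω p q μ (weakGradient Ω (toAEEqFun u)) + modular Ω p q μ (toAEEqFun u)

/-- The norm `‖u‖_{ρ̂_H} = inf {τ > 0 : ρ̂_H(u / τ) ≤ 1}`. -/
instance instNorm : Norm (W1H h) :=
  ⟨fun u => sInf {τ : ℝ | 0 < τ ∧ modularHat (τ⁻¹ • u) ≤ 1}⟩

theorem exists_isWeakGradient (u : W1H h) : ∃ g, IsWeakGradient Ω (toAEEqFun u) g := u.2.1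

theorem isWeakGradient (u : W1H h) :
    IsWeakGradient Ω (toAEEqFun u) (weakGradient Ω (toAEEqFun u)) := by
  obtain ⟨g, hg⟩ := exists_isWeakGradient u
  rwa [hg.weakGradient_eq h.isOpen]

theorem weakGradient_add (u v : W1H h) : weakGradient Ω (toAEEqFun (u + v))
    = weakGradient Ω (toAEEqFun u) + weakGradient Ω (toAEEqFun v) := by
  rw [map_add]
  exact ((isWeakGradient u).add h.isOpen (isWeakGradient v)).weakGradient_eq h.isOpen

theorem weakGradient_smul (c : ℝ) (u : W1H h) : weakGradient Ω (toAEEqFun (c • u))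
    = c • weakGradient Ω (toAEEqFun u) := by
  rw [map_smul]
  exact ((isWeakGradient u).smul h.isOpen c).weakGradient_eq h.isOpen

theorem modularHat_lt_top (u : W1H h) : modularHat u < ⊤ :=
  ENNReal.add_lt_top.2 ⟨u.2.2.2, u.2.2.1⟩

theorem modularHat_convex {a b : ℝ} (ha : 0 ≤ a) (hb : 0 ≤ b) (hab : a + b = 1) (u v : W1H h) :
    modularHat (a • u + b • v)
      ≤ ENNReal.ofReal a * modularHat u + ENNReal.ofReal b * modularHat v := by
  unfold modularHat
  rw [weakGradient_add, weakGradient_smul, weakGradient_smul, map_add, map_smul, map_smul]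
  refine (add_le_add (h.modular_convex ha hb hab _ _) (h.modular_convex ha hb hab _ _)).trans
    (le_of_eq ?_)
  ring

theorem modularHat_smul_le {c : ℝ} (hc : |c| ≤ 1) (u : W1H h) :
    modularHat (c • u) ≤ ENNReal.ofReal |c| * modularHat u := by
  unfold modularHat
  rw [weakGradient_smul, map_smul, mul_add]
  exact add_le_add (h.modular_smul_le hc _) (h.modular_smul_le hc _)

theorem eq_zero_of_modularHat {u : W1H h} (hu : modularHat u = 0) : u = 0 := by
  have h1 : toAEEqFun u = 0 := h.eq_zero_of_modular _ (add_eq_zero.1 hu).2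
  exact Subtype.ext h1

/-- The unit modular ball. -/
def unitBall (h : Hypotheses Ω p q μ) : Set (W1H h) := {u | modularHat u ≤ 1}

theorem norm_eq_gauge (u : W1H h) : ‖u‖ = gauge (unitBall h) u := by
  rw [gauge_def']
  rfl

theorem convex_unitBall : Convex ℝ (unitBall h) := by
  intro u hu v hv a b ha hb hab
  refine (modularHat_convex ha hb hab u v).trans ?_
  calc ENNReal.ofReal a * modularHat u + ENNReal.ofReal b * modularHat v
      ≤ ENNReal.ofReal a * 1 + ENNReal.ofReal b * 1 := by gcongr <;> assumption
    _ = 1 := by rw [mul_one, mul_one, ← ENNReal.ofReal_add ha hb, hab, ENNReal.ofReal_one]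

theorem balanced_unitBall : Balanced ℝ (unitBall h) := by
  rw [balanced_iff_smul_mem]
  intro c hc u hu
  refine (modularHat_smul_le hc u).trans ?_
  calc ENNReal.ofReal |c| * modularHat u ≤ 1 * 1 := by
        gcongr
        · exact ENNReal.ofReal_le_one.2 hc
        · exact hu
    _ = 1 := one_mul 1

theorem modularHat_smul_le_of_pos {t : ℝ} (ht : 0 ≤ t) (ht1 : t ≤ 1) (u : W1H h) :
    modularHat (t • u) ≤ ENNReal.ofReal t * modularHat u := by
  have := modularHat_smul_le (c := t) (by rwa [abs_of_nonneg ht]) u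
  rwa [abs_of_nonneg ht] at this

theorem absorbent_unitBall : Absorbent ℝ (unitBall h) := by
  rw [absorbent_iff_inv_smul]
  intro u
  filter_upwards [eventually_cobounded_le_norm (E := ℝ) (max 1 (modularHat u).toReal)] with c hc
  have hc1 : 1 ≤ |c| := (le_max_left _ _).trans hc
  have hcu : (modularHat u).toReal ≤ |c| := (le_max_right _ _).trans hc
  have hc0 : 0 < |c| := by linarith
  have h1 : |c⁻¹| ≤ 1 := by
    rw [abs_inv]
    exact inv_le_one_of_one_le₀ hc1
  refine (modularHat_smul_le h1 u).trans ?_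
  rw [← ENNReal.ofReal_toReal (modularHat_lt_top u).ne, ← ENNReal.ofReal_mul (abs_nonneg _),
    ENNReal.ofReal_le_one, abs_inv]
  rw [inv_mul_le_iff₀ hc0]
  linarith

theorem eq_zero_of_norm_eq_zero {u : W1H h} (hu : ‖u‖ = 0) : u = 0 := by
  apply eq_zero_of_modularHat
  by_contra hne
  have hpos : 0 < (modularHat u).toReal := ENNReal.toReal_pos hne (modularHat_lt_top u).ne
  have hlt : gauge (unitBall h) u < min 1 ((modularHat u).toReal / 2) := by
    rw [← norm_eq_gauge, hu]
    positivity
  obtain ⟨t, ht0, htlt, w, hw, rfl⟩ := exists_lt_of_gauge_lt absorbent_unitBall hlt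
  have h1 : t ≤ 1 := htlt.le.trans (min_le_left _ _)
  have h2 := htlt.trans_le (min_le_right _ _)
  have h3 : modularHat (t • w) ≤ ENNReal.ofReal t := by
    refine (modularHat_smul_le_of_pos ht0.le h1 w).trans ?_
    calc ENNReal.ofReal t * modularHat w ≤ ENNReal.ofReal t * 1 := by gcongr; exact hw
      _ = _ := mul_one _
  have h4 := ENNReal.toReal_le_of_le_ofReal ht0.le h3
  simp only at h2 hpos
  linarith

theorem normedSpaceCore (h : Hypotheses Ω p q μ) : NormedSpace.Core ℝ (W1H h) where
  norm_nonneg u := by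
    rw [norm_eq_gauge]
    exact gauge_nonneg u
  norm_smul c u := by
    rw [norm_eq_gauge, norm_eq_gauge, gauge_smul balanced_unitBall]
  norm_triangle u v := by
    rw [norm_eq_gauge, norm_eq_gauge, norm_eq_gauge]
    exact gauge_add_le convex_unitBall absorbent_unitBall u v
  norm_eq_zero_iff u := by
    refine ⟨eq_zero_of_norm_eq_zero, ?_⟩
    rintro rfl
    rw [norm_eq_gauge, gauge_zero]

/-- `W^{1,H}(Ω)` normed by `‖·‖_{ρ̂_H}`. -/
instance instNormedAddCommGroup : NormedAddCommGroup (W1H h) :=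
  NormedAddCommGroup.ofCore (normedSpaceCore h)

instance instNormedSpace : NormedSpace ℝ (W1H h) :=
  NormedSpace.ofCore (normedSpaceCore h)

end W1H

end DoublePhase

end

/-!
Strict convexity of a norm makes `(‖a‖ ^ s + ‖b‖ ^ s) / 2 - ‖(a + b) / 2‖ ^ s` positive for `a ≠ b`,
while `‖(a - b) / 2‖ ^ s` vanishes for `a = b`. By homogeneity it suffices to compare the two on a
unit sphere, and compactness of this sphere and of the range of exponents yields the inequality
`‖(a + b) / 2‖ ^ s + δ ‖(a - b) / 2‖ ^ s ≤ (1 + δ ε) / 2 * (‖a‖ ^ s + ‖b‖ ^ s)` with `δ` uniform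
in `s`. It is additive in the function `‖·‖ ^ s`, so it integrates to the modular `ρ̂_H`.

The modular grows at most polynomially along rays, so a small modular forces a small norm, and a
modular at most `1 - η` forces a norm at most `1 - κ`; this gives uniform convexity. For the second
claim apply the inequality to `u n` and `u₀`: the modular is convex and continuous, hence
weakly lower semicontinuous, so the modulars of the midpoints cannot drop below that of `u₀` in the
limit, and the modular of `(u n - u₀) / 2` tends to `0`.
-/

namespace DoublePhase

open scoped NNReal

section Clarkson

variable {E E' β : Type*} [AddCommGroup E] [Module ℝ E] [AddCommGroup E'] [Module ℝ E']

/-- The relaxed Clarkson inequality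
`φ ((a + b) / 2) + δ φ ((a - b) / 2) ≤ (1 + δ ε) / 2 * (φ a + φ b)` for a function `φ` on a real
vector space. Clarkson's classical inequality is the case `δ = 1`, `ε = 0`, `φ = ‖·‖ ^ s` with
`2 ≤ s`. Being additive in `φ`, it is preserved by sums and integrals. The constants are taken in
`ℝ≥0` so that they act both on `ℝ` and on `ℝ≥0∞`. -/
def ClarksonWith [AddCommMonoid β] [LE β] [SMul ℝ≥0 β] (δ ε : ℝ≥0) (φ : E → β) : Prop :=
  ∀ a b : E, φ ((2⁻¹ : ℝ) • (a + b)) + δ • φ ((2⁻¹ : ℝ) • (a - b))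
    ≤ ((1 + δ * ε) / 2) • (φ a + φ b)

/-- Uniform convexity of a modular: if `φ ((a - b) / 2)` is not small compared with `φ a + φ b`,
then `φ ((a + b) / 2)` is smaller than the mean of `φ a` and `φ b` by a fixed fraction. It is
encoded by relaxed Clarkson inequalities, with arbitrarily small `ε`. -/
def IsUniformlyConvexModular [AddCommMonoid β] [LE β] [SMul ℝ≥0 β] (φ : E → β) : Prop :=
  ∀ ε : ℝ≥0, 0 < ε → ∀ᶠ δ in 𝓝[>] 0, ClarksonWith δ ε φ

namespace ClarksonWith

variable {δ ε : ℝ≥0}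

theorem comp_linearMap [AddCommMonoid β] [LE β] [SMul ℝ≥0 β] {φ : E' → β}
    (hφ : ClarksonWith δ ε φ) (T : E →ₗ[ℝ] E') : ClarksonWith δ ε (fun a => φ (T a)) := by
  intro a b
  simpa only [map_smul, map_add, map_sub] using hφ (T a) (T b)

theorem add [AddCommMonoid β] [PartialOrder β] [IsOrderedAddMonoid β] [DistribSMul ℝ≥0 β]
    {φ ψ : E → β} (hφ : ClarksonWith δ ε φ) (hψ : ClarksonWith δ ε ψ) :
    ClarksonWith δ ε (fun a => φ a + ψ a) := by
  intro a b
  simpa only [smul_add, add_add_add_comm] using add_le_add (hφ a b) (hψ a b)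

theorem const_mul {φ : E → ℝ} (hφ : ClarksonWith δ ε φ) {c : ℝ} (hc : 0 ≤ c) :
    ClarksonWith δ ε (fun a => c * φ a) := by
  intro a b
  simpa only [mul_add, mul_smul_comm] using mul_le_mul_of_nonneg_left (hφ a b) hc

theorem ennrealOfReal {φ : E → ℝ} (hφ : ClarksonWith δ ε φ) (hφ0 : ∀ a, 0 ≤ φ a) :
    ClarksonWith δ ε (fun a => ENNReal.ofReal (φ a)) := by
  intro a b
  have ofReal_nnreal_smul (c : ℝ≥0) (t : ℝ) :
      c • ENNReal.ofReal t = ENNReal.ofReal (c • t) := by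
    rw [ENNReal.smul_def, NNReal.smul_def, smul_eq_mul, smul_eq_mul,
      ENNReal.ofReal_mul c.coe_nonneg, ENNReal.ofReal_coe_nnreal]
  have hdiff : 0 ≤ δ • φ ((2⁻¹ : ℝ) • (a - b)) := mul_nonneg δ.coe_nonneg (hφ0 _)
  beta_reduce
  rw [ofReal_nnreal_smul, ← ENNReal.ofReal_add (hφ0 _) hdiff,
    ← ENNReal.ofReal_add (hφ0 a) (hφ0 b), ofReal_nnreal_smul]
  exact ENNReal.ofReal_le_ofReal (hφ a b)

theorem ennrealToReal {φ : E → ℝ≥0∞} (hφ : ClarksonWith δ ε φ) (hφtop : ∀ a, φ a ≠ ⊤) :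
    ClarksonWith δ ε (fun a => (φ a).toReal) := by
  intro a b
  have hsum : φ a + φ b ≠ ⊤ := ENNReal.add_ne_top.2 ⟨hφtop a, hφtop b⟩
  have hdiff : δ • φ ((2⁻¹ : ℝ) • (a - b)) ≠ ⊤ :=
    ENNReal.mul_ne_top ENNReal.coe_ne_top (hφtop _)
  have hmean : ((1 + δ * ε) / 2) • (φ a + φ b) ≠ ⊤ := ENNReal.mul_ne_top ENNReal.coe_ne_top hsum
  have hle := ENNReal.toReal_mono hmean (hφ a b)
  rwa [ENNReal.toReal_add (hφtop _) hdiff, ENNReal.toReal_smul, ENNReal.toReal_smul,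
    ENNReal.toReal_add (hφtop a) (hφtop b)] at hle

theorem lintegral {α F : Type*} [MeasurableSpace α] {ν : Measure α} [NormedAddCommGroup F]
    [NormedSpace ℝ F] {Φ : α → F → ℝ≥0∞}
    (hmeas : ∀ u : α →ₘ[ν] F, AEMeasurable (fun x => Φ x (u x)) ν)
    (hΦ : ∀ᵐ x ∂ν, ClarksonWith δ ε (Φ x)) :
    ClarksonWith δ ε (fun u : α →ₘ[ν] F => ∫⁻ x, Φ x (u x) ∂ν) := by
  intro u v
  simp only [ENNReal.smul_def, smul_eq_mul]
  rw [← lintegral_const_mul'' _ (hmeas _), ← lintegral_add_left' (hmeas _),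
    ← lintegral_add_left' (hmeas u), ← lintegral_const_mul'' _ ((hmeas u).fun_add (hmeas v))]
  refine lintegral_mono_ae ?_
  filter_upwards [hΦ, AEEqFun.coeFn_smul (2⁻¹ : ℝ) (u + v), AEEqFun.coeFn_smul (2⁻¹ : ℝ) (u - v),
    AEEqFun.coeFn_add u v, AEEqFun.coeFn_sub u v] with x hx hsum hdiff hadd hsub
  rw [hsum, hdiff, Pi.smul_apply, Pi.smul_apply, hadd, hsub]
  exact hx (u x) (v x)

end ClarksonWith

end Clarkson

section Power

theorem eventually_forall_mul_le_of_isCompact {X : Type*} [TopologicalSpace X] {K : Set X}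
    (hK : IsCompact K) {D G : X → ℝ} (hD : ContinuousOn D K) (hG : ContinuousOn G K)
    (hG0 : ∀ z ∈ K, 0 ≤ G z) (hDG : ∀ z ∈ K, D z < 0 ∨ 0 < G z) :
    ∀ᶠ δ : ℝ≥0 in 𝓝 0, ∀ z ∈ K, δ * D z ≤ G z := by
  refine hK.induction_on (p := fun s => ∀ᶠ δ : ℝ≥0 in 𝓝 0, ∀ z ∈ s, δ * D z ≤ G z)
    (by simp) (fun s t hst ht => ht.mono fun δ hδ z hz => hδ z (hst hz))
    (fun s t hs ht => (hs.and ht).mono fun δ hδ z hz => hz.elim (hδ.1 z) (hδ.2 z)) ?_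
  intro z hz
  rcases hDG z hz with hneg | hpos
  · refine ⟨{w ∈ K | D w < 0}, (eventually_mem_nhdsWithin).and ((hD z hz).eventually_lt_const hneg),
      Eventually.of_forall fun δ w hw => ?_⟩
    exact (mul_nonpos_of_nonneg_of_nonpos δ.coe_nonneg hw.2.le).trans (hG0 w hw.1)
  · refine ⟨{w | D w < |D z| + 1 ∧ G z / 2 < G w},
      ((hD z hz).eventually_lt_const (by linarith [le_abs_self (D z)])).and
        ((hG z hz).eventually_const_lt (half_lt_self hpos)), ?_⟩
    have hlim : Tendsto (fun δ : ℝ≥0 => (δ : ℝ) * (|D z| + 1)) (𝓝 0) (𝓝 0) := by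
      have hcont : Continuous fun δ : ℝ≥0 => (δ : ℝ) * (|D z| + 1) := by fun_prop
      simpa using hcont.tendsto 0
    filter_upwards [hlim.eventually_lt_const (half_pos hpos)] with δ hδ w hw
    calc (δ : ℝ) * D w ≤ δ * (|D z| + 1) := mul_le_mul_of_nonneg_left hw.1.le δ.coe_nonneg
      _ ≤ G w := (hδ.trans hw.2).le

variable {F : Type*} [NormedAddCommGroup F] [NormedSpace ℝ F]

theorem strictConvexOn_norm_rpow [StrictConvexSpace ℝ F] {s : ℝ} (hs : 1 < s) :
    StrictConvexOn ℝ univ (fun a : F => ‖a‖ ^ s) := by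
  refine ⟨convex_univ, fun a _ b _ hab t r ht hr htr => ?_⟩
  have hs0 : 0 < s := zero_lt_one.trans hs
  simp only [smul_eq_mul]
  rcases eq_or_ne ‖a‖ ‖b‖ with heq | hne
  · rw [← heq, ← add_mul, htr, one_mul]
    exact Real.rpow_lt_rpow (norm_nonneg _) (norm_combo_lt_of_ne le_rfl heq.ge hab ht hr htr) hs0
  · calc ‖t • a + r • b‖ ^ s ≤ (t * ‖a‖ + r * ‖b‖) ^ s := by
          refine Real.rpow_le_rpow (norm_nonneg _) ((norm_add_le _ _).trans_eq ?_) hs0.le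
          rw [norm_smul_of_nonneg ht.le, norm_smul_of_nonneg hr.le]
      _ < t * ‖a‖ ^ s + r * ‖b‖ ^ s :=
          (strictConvexOn_rpow hs).2 (norm_nonneg a) (norm_nonneg b) hne ht hr htr

theorem norm_half_add_rpow_lt [StrictConvexSpace ℝ F] {s : ℝ} (hs : 1 < s) {a b : F}
    (hab : a ≠ b) : ‖(2⁻¹ : ℝ) • (a + b)‖ ^ s < (‖a‖ ^ s + ‖b‖ ^ s) / 2 := by
  have hstrict := (strictConvexOn_norm_rpow hs).2 (mem_univ a) (mem_univ b) hab
    (by norm_num : (0 : ℝ) < 2⁻¹) (by norm_num : (0 : ℝ) < 2⁻¹) (by norm_num)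
  simp only [← smul_add, smul_eq_mul] at hstrict
  linarith

theorem norm_half_add_rpow_le [StrictConvexSpace ℝ F] {s : ℝ} (hs : 1 < s) (a b : F) :
    ‖(2⁻¹ : ℝ) • (a + b)‖ ^ s ≤ (‖a‖ ^ s + ‖b‖ ^ s) / 2 := by
  rcases eq_or_ne a b with rfl | hab
  · rw [← two_smul ℝ a, inv_smul_smul₀ two_ne_zero, add_self_div_two]
  · exact (norm_half_add_rpow_lt hs hab).le

theorem clarksonWith_norm_rpow_of_sphere {δ ε : ℝ≥0} {s : ℝ} (hs : 0 < s)
    (hsphere : ∀ z ∈ Metric.sphere (0 : F × F) 1,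
      ‖(2⁻¹ : ℝ) • (z.1 + z.2)‖ ^ s + δ • ‖(2⁻¹ : ℝ) • (z.1 - z.2)‖ ^ s
        ≤ ((1 + δ * ε) / 2) • (‖z.1‖ ^ s + ‖z.2‖ ^ s)) :
    ClarksonWith δ ε (fun a : F => ‖a‖ ^ s) := by
  intro a b
  rcases eq_or_ne (a, b) 0 with h0 | h0
  · obtain ⟨rfl, rfl⟩ := Prod.mk_eq_zero.1 h0
    simp [Real.zero_rpow hs.ne']
  set r := ‖(a, b)‖
  have hr : 0 < r := norm_pos_iff.2 h0
  have norm_rpow_eq (c : F) : ‖c‖ ^ s = r ^ s * ‖r⁻¹ • c‖ ^ s := by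
    rw [← Real.mul_rpow hr.le (norm_nonneg _), ← norm_smul_of_nonneg hr.le,
      smul_inv_smul₀ hr.ne']
  have hunit : ‖r⁻¹ • (a, b)‖ = 1 := by
    rw [norm_smul_of_nonneg (inv_nonneg.2 hr.le), inv_mul_cancel₀ hr.ne']
  have hscaled := mul_le_mul_of_nonneg_left
    (hsphere (r⁻¹ • (a, b)) (mem_sphere_zero_iff_norm.2 hunit)) (Real.rpow_nonneg hr.le s)
  beta_reduce
  rw [norm_rpow_eq a, norm_rpow_eq b, norm_rpow_eq ((2⁻¹ : ℝ) • (a + b)),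
    norm_rpow_eq ((2⁻¹ : ℝ) • (a - b))]
  simpa only [smul_comm r⁻¹ (2⁻¹ : ℝ), smul_add, smul_sub, mul_add, mul_smul_comm,
    Prod.smul_mk] using hscaled

theorem eventually_clarksonWith_norm_rpow [StrictConvexSpace ℝ F] [ProperSpace F] {S : Set ℝ}
    (hS : IsCompact S) (hS1 : ∀ s ∈ S, 1 < s) {ε : ℝ≥0} (hε : 0 < ε) :
    ∀ᶠ δ : ℝ≥0 in 𝓝[>] 0, ∀ s ∈ S, ClarksonWith δ ε (fun a : F => ‖a‖ ^ s) := by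
  let K : Set (ℝ × F × F) := S ×ˢ Metric.sphere 0 1
  let D : ℝ × F × F → ℝ := fun z =>
    ‖(2⁻¹ : ℝ) • (z.2.1 - z.2.2)‖ ^ z.1 - ε / 2 * (‖z.2.1‖ ^ z.1 + ‖z.2.2‖ ^ z.1)
  let G : ℝ × F × F → ℝ := fun z =>
    (‖z.2.1‖ ^ z.1 + ‖z.2.2‖ ^ z.1) / 2 - ‖(2⁻¹ : ℝ) • (z.2.1 + z.2.2)‖ ^ z.1
  have hpow {f : ℝ × F × F → F} (hf : Continuous f) : ContinuousOn (fun z => ‖f z‖ ^ z.1) K :=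
    hf.norm.continuousOn.rpow continuous_fst.continuousOn
      fun z hz => Or.inr (zero_lt_one.trans (hS1 z.1 hz.1))
  have hsum : ContinuousOn (fun z : ℝ × F × F => ‖z.2.1‖ ^ z.1 + ‖z.2.2‖ ^ z.1) K :=
    (hpow (by fun_prop)).add (hpow (by fun_prop))
  have hD : ContinuousOn D K := (hpow (by fun_prop)).sub (continuousOn_const.mul hsum)
  have hG : ContinuousOn G K := (hsum.div_const 2).sub (hpow (by fun_prop))
  have hG0 : ∀ z ∈ K, 0 ≤ G z := fun z hz =>
    sub_nonneg.2 (norm_half_add_rpow_le (hS1 z.1 hz.1) z.2.1 z.2.2)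
  have hDG : ∀ z ∈ K, D z < 0 ∨ 0 < G z := by
    rintro ⟨s, a, b⟩ ⟨hs, hab⟩
    rcases eq_or_ne a b with rfl | hne
    · left
      have ha : ‖a‖ = 1 := by simpa [Prod.norm_def] using hab
      simp [D, ha, Real.zero_rpow (zero_lt_one.trans (hS1 s hs)).ne', hε]
    · exact Or.inr (sub_pos.2 (norm_half_add_rpow_lt (hS1 s hs) hne))
  filter_upwards [nhdsWithin_le_nhds (eventually_forall_mul_le_of_isCompact
    (hS.prod (isCompact_sphere 0 1)) hD hG hG0 hDG)] with δ hδ s hs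
  refine clarksonWith_norm_rpow_of_sphere (zero_lt_one.trans (hS1 s hs)) fun z hz => ?_
  have hDGz := hδ (s, z) ⟨hs, hz⟩
  simp only [D, G] at hDGz
  simp only [NNReal.smul_def, smul_eq_mul, NNReal.coe_div, NNReal.coe_add, NNReal.coe_mul,
    NNReal.coe_one, NNReal.coe_ofNat]
  linarith

end Power

section Abstract

variable {E : Type*} [NormedAddCommGroup E] [NormedSpace ℝ E]

theorem lowerSemicontinuous_toWeakSpace_symm_of_convexOn {f : E → ℝ} (hf : ConvexOn ℝ univ f)
    (hlsc : LowerSemicontinuous f) :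
    LowerSemicontinuous fun w : WeakSpace ℝ E => f ((toWeakSpace ℝ E).symm w) := by
  rw [lowerSemicontinuous_iff_isClosed_preimage]
  intro c
  have hconv : Convex ℝ (f ⁻¹' Iic c) := by simpa [preimage] using hf.convex_le c
  have himage : (fun w : WeakSpace ℝ E => f ((toWeakSpace ℝ E).symm w)) ⁻¹' Iic c
      = toWeakSpace ℝ E '' (f ⁻¹' Iic c) :=
    ((toWeakSpace ℝ E).image_eq_preimage_symm (f ⁻¹' Iic c)).symm
  rw [himage, ← (hlsc.isClosed_preimage c).closure_eq, hconv.toWeakSpace_closure ℝ]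
  exact isClosed_closure

/-- `ρ` has the properties of a convex modular of polynomial growth (that is, satisfying the `Δ₂`
condition) whose Luxemburg norm `inf {τ > 0 : ρ (u / τ) ≤ 1}` is the norm of `E`. The last point is
encoded by the equivalent condition that `{ρ ≤ 1}` is the closed unit ball. -/
structure IsLuxemburgModular (ρ : E → ℝ) : Prop where
  convexOn : ConvexOn ℝ univ ρ
  norm_le_one_iff : ∀ u, ‖u‖ ≤ 1 ↔ ρ u ≤ 1
  exists_smul_le : ∃ Q : ℝ, 0 < Q ∧ ∀ c : ℝ, 1 ≤ c → ∀ u, ρ (c • u) ≤ c ^ Q * ρ u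

namespace IsLuxemburgModular

variable {ρ : E → ℝ}

theorem continuous (hρ : IsLuxemburgModular ρ) : Continuous ρ := by
  rw [← continuousOn_univ]
  refine ((hρ.convexOn.continuousOn_tfae isOpen_univ univ_nonempty).out 3 1).1 ?_
  refine ⟨0, mem_univ _, 1, eventually_map.2 ?_⟩
  filter_upwards [Metric.closedBall_mem_nhds (0 : E) one_pos] with u hu
  exact (hρ.norm_le_one_iff u).1 (mem_closedBall_zero_iff.1 hu)

theorem exists_norm_le_of_le_rpow (hρ : IsLuxemburgModular ρ) :
    ∃ Q : ℝ, 0 < Q ∧ ∀ θ : ℝ, 0 < θ → θ ≤ 1 → ∀ u, ρ u ≤ θ ^ Q → ‖u‖ ≤ θ := by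
  obtain ⟨Q, hQ, hgrowth⟩ := hρ.exists_smul_le
  refine ⟨Q, hQ, fun θ hθ hθ1 u hu => ?_⟩
  have hball : ‖θ⁻¹ • u‖ ≤ 1 := by
    rw [hρ.norm_le_one_iff]
    calc ρ (θ⁻¹ • u) ≤ θ⁻¹ ^ Q * ρ u := hgrowth _ ((one_le_inv₀ hθ).2 hθ1) u
      _ = (θ ^ Q)⁻¹ * ρ u := by rw [Real.inv_rpow hθ.le]
      _ ≤ 1 := inv_mul_le_one_of_le₀ hu (Real.rpow_nonneg hθ.le Q)
  rwa [norm_smul_of_nonneg (inv_nonneg.2 hθ.le), inv_mul_le_iff₀ hθ, mul_one] at hball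

theorem exists_norm_le_of_le (hρ : IsLuxemburgModular ρ) {ε : ℝ} (hε : 0 < ε) :
    ∃ η : ℝ, 0 < η ∧ ∀ u, ρ u ≤ η → ‖u‖ ≤ ε := by
  obtain ⟨Q, -, hnorm⟩ := hρ.exists_norm_le_of_le_rpow
  have hθ : 0 < min ε 1 := lt_min hε one_pos
  exact ⟨min ε 1 ^ Q, Real.rpow_pos_of_pos hθ Q,
    fun u hu => (hnorm _ hθ (min_le_right ε 1) u hu).trans (min_le_left ε 1)⟩

theorem exists_norm_le_one_sub_of_le_one_sub (hρ : IsLuxemburgModular ρ) {η : ℝ} (hη : 0 < η) :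
    ∃ κ : ℝ, 0 < κ ∧ ∀ u, ρ u ≤ 1 - η → ‖u‖ ≤ 1 - κ := by
  obtain ⟨Q, hQ, hnorm⟩ := hρ.exists_norm_le_of_le_rpow
  set t := max 2⁻¹ (1 - η)
  have ht0 : 0 < t := lt_max_of_lt_left (by norm_num)
  have ht1 : t < 1 := max_lt (by norm_num) (by linarith)
  have hθ1 : t ^ Q⁻¹ < 1 := Real.rpow_lt_one ht0.le ht1 (inv_pos.2 hQ)
  refine ⟨1 - t ^ Q⁻¹, sub_pos.2 hθ1, fun u hu => ?_⟩
  rw [sub_sub_cancel]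
  refine hnorm _ (Real.rpow_pos_of_pos ht0 _) hθ1.le u ?_
  rw [Real.rpow_inv_rpow ht0.le hQ.ne']
  exact hu.trans (le_max_right _ _)

theorem uniformConvexSpace (hρ : IsLuxemburgModular ρ) (huc : IsUniformlyConvexModular ρ) :
    UniformConvexSpace E := by
  refine ⟨fun ε hε => ?_⟩
  obtain ⟨η, hη, hsmall⟩ := hρ.exists_norm_le_of_le (ε := ε / 4) (by positivity)
  lift η to ℝ≥0 using hη.le
  obtain ⟨δ, hclarkson, hδ : 0 < δ⟩ :=
    ((huc (η / 2) (half_pos (NNReal.coe_pos.1 hη))).and self_mem_nhdsWithin).exists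
  obtain ⟨κ, hκ, hgap⟩ := hρ.exists_norm_le_one_sub_of_le_one_sub (η := δ * η / 2) (by positivity)
  refine ⟨2 * κ, by positivity, fun u hu v hv huv => ?_⟩
  have hlarge : η < ρ ((2⁻¹ : ℝ) • (u - v)) := by
    by_contra! hle
    have hnorm := hsmall _ hle
    rw [norm_smul_of_nonneg (by norm_num)] at hnorm
    linarith
  have hmid : ρ ((2⁻¹ : ℝ) • (u + v)) ≤ 1 - δ * η / 2 := by
    have hineq : ρ ((2⁻¹ : ℝ) • (u + v)) + δ * ρ ((2⁻¹ : ℝ) • (u - v))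
        ≤ (1 + δ * (η / 2)) / 2 * (ρ u + ρ v) := hclarkson u v
    have hmean : (1 + δ * (η / 2)) / 2 * (ρ u + ρ v) ≤ (1 + δ * (η / 2) : ℝ) / 2 * (1 + 1) := by
      gcongr
      · exact (hρ.norm_le_one_iff u).1 hu.le
      · exact (hρ.norm_le_one_iff v).1 hv.le
    have hdiff : (δ : ℝ) * η ≤ δ * ρ ((2⁻¹ : ℝ) • (u - v)) := by gcongr
    linarith
  have hnorm := hgap _ hmid
  rw [norm_smul_of_nonneg (by norm_num)] at hnorm
  linarith

variable {ι : Type*} {l : Filter ι} {u : ι → E} {u₀ : E}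

theorem eventually_lt_half_add (hρ : IsLuxemburgModular ρ)
    (hu : Tendsto (fun i => toWeakSpace ℝ E (u i)) l (𝓝 (toWeakSpace ℝ E u₀)))
    {c : ℝ} (hc : c < ρ u₀) : ∀ᶠ i in l, c < ρ ((2⁻¹ : ℝ) • (u i + u₀)) := by
  have hmid : Tendsto (fun i => toWeakSpace ℝ E ((2⁻¹ : ℝ) • (u i + u₀))) l
      (𝓝 (toWeakSpace ℝ E u₀)) := by
    have hlim := (hu.add_const (toWeakSpace ℝ E u₀)).const_smul (2⁻¹ : ℝ)
    rw [← two_smul ℝ, inv_smul_smul₀ two_ne_zero] at hlim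
    simpa only [map_smul, map_add] using hlim
  simpa only [LinearEquiv.symm_apply_apply] using
    hmid.eventually (lowerSemicontinuous_toWeakSpace_symm_of_convexOn hρ.convexOn
      hρ.continuous.lowerSemicontinuous (toWeakSpace ℝ E u₀) c (by simpa using hc))

theorem eventually_half_sub_lt (hρ : IsLuxemburgModular ρ) (huc : IsUniformlyConvexModular ρ)
    (hu : Tendsto (fun i => toWeakSpace ℝ E (u i)) l (𝓝 (toWeakSpace ℝ E u₀)))
    (hρu : Tendsto (fun i => ρ (u i)) l (𝓝 (ρ u₀))) {η : ℝ} (hη : 0 < η) :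
    ∀ᶠ i in l, ρ ((2⁻¹ : ℝ) • (u i - u₀)) < η := by
  obtain ⟨ε, hεM, hε⟩ : ∃ ε : ℝ≥0, ε * ρ u₀ < η / 2 ∧ 0 < ε := by
    have hlim : Tendsto (fun ε : ℝ≥0 => (ε : ℝ) * ρ u₀) (𝓝[>] 0) (𝓝 0) := by
      have hcont : Continuous fun ε : ℝ≥0 => (ε : ℝ) * ρ u₀ := by fun_prop
      simpa using (hcont.tendsto 0).mono_left nhdsWithin_le_nhds
    exact ((hlim.eventually_lt_const (half_pos hη)).and self_mem_nhdsWithin).exists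
  obtain ⟨δ, hclarkson, hδ : 0 < δ⟩ := ((huc ε hε).and self_mem_nhdsWithin).exists
  have hδ' : (0 : ℝ) < δ := NNReal.coe_pos.2 hδ
  have hδεM : (δ : ℝ) * (ε * ρ u₀) < δ * (η / 2) := mul_lt_mul_of_pos_left hεM hδ'
  have hmean : ∀ᶠ i in l, (1 + δ * ε : ℝ) / 2 * (ρ (u i) + ρ u₀) < ρ u₀ + δ * (η / 2) :=
    ((hρu.add_const (ρ u₀)).const_mul _).eventually_lt_const (by linarith)
  have hmid : ∀ᶠ i in l, ρ u₀ - δ * (η / 2) < ρ ((2⁻¹ : ℝ) • (u i + u₀)) :=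
    hρ.eventually_lt_half_add hu (sub_lt_self _ (by positivity))
  filter_upwards [hmean, hmid] with i hmean_i hmid_i
  have hineq : ρ ((2⁻¹ : ℝ) • (u i + u₀)) + δ * ρ ((2⁻¹ : ℝ) • (u i - u₀))
      ≤ (1 + δ * ε) / 2 * (ρ (u i) + ρ u₀) := hclarkson (u i) u₀
  refine lt_of_mul_lt_mul_left ?_ hδ'.le
  linarith

theorem tendsto_of_tendsto_toWeakSpace (hρ : IsLuxemburgModular ρ)
    (huc : IsUniformlyConvexModular ρ)
    (hu : Tendsto (fun i => toWeakSpace ℝ E (u i)) l (𝓝 (toWeakSpace ℝ E u₀)))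
    (hρu : Tendsto (fun i => ρ (u i)) l (𝓝 (ρ u₀))) : Tendsto u l (𝓝 u₀) := by
  rw [Metric.tendsto_nhds]
  intro ε hε
  obtain ⟨η, hη, hsmall⟩ := hρ.exists_norm_le_of_le (ε := ε / 4) (by positivity)
  filter_upwards [hρ.eventually_half_sub_lt huc hu hρu hη] with i hi
  have hnorm := hsmall _ hi.le
  rw [norm_smul_of_nonneg (by norm_num), ← dist_eq_norm] at hnorm
  linarith

end IsLuxemburgModular

end Abstract

section ModularConvexity

variable {N : ℕ} {Ω : Set (EuclideanSpace ℝ (Fin N))} {p q μ : EuclideanSpace ℝ (Fin N) → ℝ}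

theorem Hypotheses.exists_exponent_bound (h : Hypotheses Ω p q μ) :
    ∃ Q : ℝ, 0 < Q ∧ ∀ x ∈ Ω, q x ≤ Q := by
  obtain ⟨Q, hQ⟩ := (h.isBounded.isCompact_closure.image_of_continuousOn h.continuousOn_q).bddAbove
  exact ⟨max Q 1, lt_max_of_lt_right one_pos,
    fun x hx => le_max_of_le_left (hQ (mem_image_of_mem q (subset_closure hx)))⟩

variable {F : Type*} [NormedAddCommGroup F] [NormedSpace ℝ F]

theorem Hypotheses.modular_smul_le_rpow (h : Hypotheses Ω p q μ) {Q : ℝ}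
    (hQ : ∀ x ∈ Ω, q x ≤ Q) {c : ℝ} (hc : 1 ≤ c)
    (u : EuclideanSpace ℝ (Fin N) →ₘ[volume.restrict Ω] F) :
    modular Ω p q μ (c • u) ≤ ENNReal.ofReal (c ^ Q) * modular Ω p q μ u := by
  have hc0 : 0 ≤ c := zero_le_one.trans hc
  unfold modular
  rw [← lintegral_const_mul'' _ (h.aemeasurable_H u)]
  refine lintegral_mono_ae ?_
  filter_upwards [h.ae_exponents, AEEqFun.coeFn_smul c u] with x ⟨hxΩ, _, hpq, hμ⟩ hsmul
  rw [hsmul, Pi.smul_apply, norm_smul_of_nonneg hc0, ← ENNReal.ofReal_mul (by positivity)]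
  exact ENNReal.ofReal_le_ofReal (H_mul_le hpq hμ (hQ x hxΩ) hc (norm_nonneg _))

theorem Hypotheses.isUniformlyConvexModular_modular [StrictConvexSpace ℝ F] [ProperSpace F]
    (h : Hypotheses Ω p q μ) :
    IsUniformlyConvexModular
      (modular Ω p q μ : (EuclideanSpace ℝ (Fin N) →ₘ[volume.restrict Ω] F) → ℝ≥0∞) := by
  intro ε hε
  have hΩ : IsCompact (closure Ω) := h.isBounded.isCompact_closure
  have hexponents : ∀ s ∈ p '' closure Ω ∪ q '' closure Ω, 1 < s := by
    rintro s (⟨x, hx, rfl⟩ | ⟨x, hx, rfl⟩)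
    exacts [h.one_lt_p x hx, (h.one_lt_p x hx).trans (h.p_lt_q x hx)]
  filter_upwards [eventually_clarksonWith_norm_rpow (F := F)
    ((hΩ.image_of_continuousOn h.continuousOn_p).union
      (hΩ.image_of_continuousOn h.continuousOn_q)) hexponents hε] with δ hδ
  refine ClarksonWith.lintegral (Φ := fun x a => ENNReal.ofReal (H p q μ x ‖a‖)) h.aemeasurable_H ?_
  filter_upwards [h.ae_exponents] with x ⟨hxΩ, _, _, hμ⟩
  have hp := hδ (p x) (Or.inl (mem_image_of_mem p (subset_closure hxΩ)))
  have hq := hδ (q x) (Or.inr (mem_image_of_mem q (subset_closure hxΩ)))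
  exact (hp.add (hq.const_mul hμ)).ennrealOfReal fun a => H_nonneg hμ (norm_nonneg a)

end ModularConvexity

namespace W1H

variable {N : ℕ} {Ω : Set (EuclideanSpace ℝ (Fin N))} {p q μ : EuclideanSpace ℝ (Fin N) → ℝ}
  {h : Hypotheses Ω p q μ}

/-- The weak gradient as a linear map. Linearity holds on `W^{1,H}(Ω)` only: the junk value of
`weakGradient` is not additive on arbitrary classes of functions. -/
noncomputable def weakGradientLinearMap :
    W1H h →ₗ[ℝ] (EuclideanSpace ℝ (Fin N) →ₘ[volume.restrict Ω] EuclideanSpace ℝ (Fin N)) where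
  toFun u := weakGradient Ω (toAEEqFun u)
  map_add' := weakGradient_add
  map_smul' := weakGradient_smul

/-- The modular `ρ̂_H` as a real number; it is finite on `W^{1,H}(Ω)`. -/
noncomputable def realModular (u : W1H h) : ℝ := (modularHat u).toReal

theorem ofReal_realModular (u : W1H h) : ENNReal.ofReal (realModular u) = modularHat u :=
  ENNReal.ofReal_toReal (modularHat_lt_top u).ne

theorem realModular_nonneg (u : W1H h) : 0 ≤ realModular u := ENNReal.toReal_nonneg

theorem modularHat_le_one_iff {u : W1H h} : modularHat u ≤ 1 ↔ realModular u ≤ 1 := by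
  rw [← ofReal_realModular, ENNReal.ofReal_le_one]

theorem convexOn_realModular : ConvexOn ℝ univ (realModular : W1H h → ℝ) := by
  refine ⟨convex_univ, fun u _ v _ a b ha hb hab => ?_⟩
  simp only [smul_eq_mul]
  have hau : 0 ≤ a * realModular u := mul_nonneg ha (realModular_nonneg u)
  have hbv : 0 ≤ b * realModular v := mul_nonneg hb (realModular_nonneg v)
  refine ENNReal.toReal_le_of_le_ofReal (add_nonneg hau hbv) ?_
  rw [ENNReal.ofReal_add hau hbv, ENNReal.ofReal_mul ha, ENNReal.ofReal_mul hb,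
    ofReal_realModular, ofReal_realModular]
  exact modularHat_convex ha hb hab u v

theorem exists_realModular_smul_le (h : Hypotheses Ω p q μ) :
    ∃ Q : ℝ, 0 < Q ∧ ∀ c : ℝ, 1 ≤ c → ∀ u : W1H h,
      realModular (c • u) ≤ c ^ Q * realModular u := by
  obtain ⟨Q, hQ, hqQ⟩ := h.exists_exponent_bound
  refine ⟨Q, hQ, fun c hc u => ?_⟩
  have hcQ : 0 ≤ c ^ Q := Real.rpow_nonneg (zero_le_one.trans hc) Q
  refine ENNReal.toReal_le_of_le_ofReal (mul_nonneg hcQ (realModular_nonneg u)) ?_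
  rw [ENNReal.ofReal_mul hcQ, ofReal_realModular]
  unfold modularHat
  rw [weakGradient_smul, map_smul, mul_add]
  exact add_le_add (h.modular_smul_le_rpow hqQ hc _) (h.modular_smul_le_rpow hqQ hc _)

theorem norm_le_one_of_realModular_le_one {u : W1H h} (hu : realModular u ≤ 1) : ‖u‖ ≤ 1 := by
  rw [norm_eq_gauge]
  exact gauge_le_one_of_mem (modularHat_le_one_iff.2 hu)

theorem realModular_le_one_of_norm_lt_one {u : W1H h} (hu : ‖u‖ < 1) : realModular u ≤ 1 := by
  rw [norm_eq_gauge] at hu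
  exact modularHat_le_one_iff.1
    (setOfPred_gauge_lt_one_subset_self convex_unitBall absorbent_unitBall.zero_mem
      absorbent_unitBall hu)

theorem realModular_le_one_of_norm_le_one {u : W1H h} (hu : ‖u‖ ≤ 1) : realModular u ≤ 1 := by
  obtain ⟨Q, -, hgrowth⟩ := exists_realModular_smul_le h
  have hlim : Tendsto (fun r : ℝ => r ^ Q) (𝓝[>] 1) (𝓝 1) := by
    have hcont : ContinuousAt (fun r : ℝ => r ^ Q) 1 :=
      Real.continuousAt_rpow_const 1 Q (Or.inl one_ne_zero)
    simpa using hcont.tendsto.mono_left nhdsWithin_le_nhds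
  refine ge_of_tendsto hlim ?_
  filter_upwards [self_mem_nhdsWithin] with r (hr : 1 < r)
  have hr0 : 0 < r := one_pos.trans hr
  have hnorm : ‖r⁻¹ • u‖ < 1 := by
    rw [norm_smul_of_nonneg (inv_nonneg.2 hr0.le), inv_mul_lt_iff₀ hr0, mul_one]
    exact hu.trans_lt hr
  calc realModular u = realModular (r • r⁻¹ • u) := by rw [smul_inv_smul₀ hr0.ne']
    _ ≤ r ^ Q * realModular (r⁻¹ • u) := hgrowth r hr.le _
    _ ≤ r ^ Q := mul_le_of_le_one_right (Real.rpow_nonneg hr0.le Q)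
        (realModular_le_one_of_norm_lt_one hnorm)

theorem isLuxemburgModular_realModular (h : Hypotheses Ω p q μ) :
    IsLuxemburgModular (realModular : W1H h → ℝ) where
  convexOn := convexOn_realModular
  norm_le_one_iff _ := ⟨realModular_le_one_of_norm_le_one, norm_le_one_of_realModular_le_one⟩
  exists_smul_le := exists_realModular_smul_le h

theorem isUniformlyConvexModular_realModular (h : Hypotheses Ω p q μ) :
    IsUniformlyConvexModular (realModular : W1H h → ℝ) := by
  intro ε hε
  filter_upwards [h.isUniformlyConvexModular_modular (F := EuclideanSpace ℝ (Fin N)) ε hε,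
    h.isUniformlyConvexModular_modular (F := ℝ) ε hε] with δ hgradient hfunction
  exact ((hgradient.comp_linearMap weakGradientLinearMap).add
    (hfunction.comp_linearMap toAEEqFun)).ennrealToReal fun u => (modularHat_lt_top u).ne

end W1H

end DoublePhase

theorem mainTheorem9 {N : ℕ} {Ω : Set (EuclideanSpace ℝ (Fin N))}
    {p q μ : EuclideanSpace ℝ (Fin N) → ℝ} (h : DoublePhase.Hypotheses Ω p q μ) :
    UniformConvexSpace (DoublePhase.W1H h) ∧
    ∀ (u : ℕ → DoublePhase.W1H h) (u₀ : DoublePhase.W1H h),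
      Tendsto (fun n => toWeakSpace ℝ (DoublePhase.W1H h) (u n)) atTop
        (𝓝 (toWeakSpace ℝ (DoublePhase.W1H h) u₀)) →
      Tendsto (fun n => DoublePhase.W1H.modularHat (u n)) atTop
        (𝓝 (DoublePhase.W1H.modularHat u₀)) →
      Tendsto u atTop (𝓝 u₀) := by
  have hlux := DoublePhase.W1H.isLuxemburgModular_realModular h
  have huc := DoublePhase.W1H.isUniformlyConvexModular_realModular h
  refine ⟨hlux.uniformConvexSpace huc, fun u u₀ hu hρ => ?_⟩
  have hρ' : Tendsto (fun n => (u n).realModular) atTop (𝓝 u₀.realModular) :=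
    (ENNReal.tendsto_toReal (DoublePhase.W1H.modularHat_lt_top u₀).ne).comp hρ
  exact hlux.tendsto_of_tendsto_toWeakSpace huc hu hρ'
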